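/- **Conventions.** Let $n,d$ be natural numbers. A tensor $\mathcal T\in\otimes^d\mathbb R^n$ has real coordinates $t_{i_1,\dots,i_d}$, $i_1,\dots,i_d\in\{1,\dots,n\}$; put $\langle\mathcal S,\mathcal T\rangle=\sum_{i_1,\dots,i_d}s_{i_1,\dots,i_d}t_{i_1,\dots,i_d}$, $\|\mathcal T\|_{HS}=\sqrt{\langle\mathcal T,\mathcal T\rangle}$ and $$\|\mathcal T\|_\sigma=\max\{|\langle\mathcal T,\mathbf x_1\otimes\cdots\otimes\mathbf x_d\rangle| : \mathbf x_1,\dots,\mathbf x_d\in\mathbb R^n,\ \|\mathbf x_1\|=\cdots=\|\mathbf x_d\|=1\},$$ where $\|\cdot\|$ is the Euclidean norm on $\mathbb R^n$. For a real homogeneous polynomial $f$ of degree $d$ in $n$ variables let $\mathcal F\in\otimes^d\mathbb R^n$ be the unique symmetric tensor (entries invariant under permutations of the indices) with $f(\mathbf x)=\langle\mathcal F,\otimes^d\mathbf x\rangle$ for all $\mathbf x\in\mathbb R^n$, and define $\|f\|_{HS}:=\|\mathcal F\|_{HS}$ and $\|f\|_\sigma:=\|\mathcal F\|_\sigma$.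 (For a power $f^k$ of a polynomial $f$ of degree $p$ these are taken with $d=kp$.) **Theorem.** Let $f$ be a nonzero real homogeneous polynomial of degree $p\ge1$ in $n$ variables. (a) Suppose that $f(\mathbf x)=a(\mathbf c^{\top}\mathbf x)^p$ for some $a\in\mathbb R\setminus\{0\}$ and $\mathbf c\in\mathbb R^n\setminus\{0\}$. Then $$\|f^k\|_{HS}=\|f^k\|_\sigma=|a|^k\|\mathbf c\|^{kp}\qquad\text{for all integers }k\ge1.$$ (b) Suppose that $f$ is not of the form $a(\mathbf c^{\top}\mathbf x)^p$ with $a\in\mathbb R\setminus\{0\}$, $\mathbf c\in\mathbb R^n\setminus\{0\}$. Then for all integers $k,l\ge1$ $$\|f^{k+l}\|_{HS}<\|f^k\|_{HS}\,\|f^l\|_{HS},\qquad \|f^{2k}\|_{HS}<\|f^k\|_{HS}^2,\qquad \|f\|_\sigma^k<\|f^k\|_{HS}.$$ Moreover the limit $\rho_1(f):=\lim_{k\to\infty}\|f^k\|_{HS}^{1/k}$ exists (as a real number), $\rho_1(f)\ge\|f\|_\sigma$, and $\rho_1(f)<\|f^k\|_{HS}^{1/k}$ for every integer $k\ge1$.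 -/

import Mathlib

open Filter Topology

noncomputable section

namespace PolyNorm

/-- A real tensor with `d` modes, each of dimension `n`, given by its array of coordinates
`t_{i_1, …, i_d}`. -/
abbrev Tensor (d n : ℕ) : Type := (Fin d → Fin n) → ℝ

/-- The standard inner product of two tensors, the sum of the products of their entries. -/
def Tensor.inner {d n : ℕ} (S T : Tensor d n) : ℝ := ∑ i, S i * T i

/-- The Hilbert-Schmidt norm of a tensor. -/
def Tensor.hsNorm {d n : ℕ} (T : Tensor d n) : ℝ := Real.sqrt (Tensor.inner T T)

/-- The rank one tensor `x_1 ⊗ ⋯ ⊗ x_d`. -/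
def Tensor.pure {d n : ℕ} (x : Fin d → EuclideanSpace ℝ (Fin n)) : Tensor d n :=
  fun i => ∏ j, x j (i j)

/-- The spectral norm of a tensor: the maximum of `|⟨T, x_1 ⊗ ⋯ ⊗ x_d⟩|` over all `d`-tuples of
Euclidean unit vectors (not necessarily equal). -/
def Tensor.spectralNorm {d n : ℕ} (T : Tensor d n) : ℝ :=
  sSup {r : ℝ | ∃ x : Fin d → EuclideanSpace ℝ (Fin n),
    (∀ j, ‖x j‖ = 1) ∧ r = |Tensor.inner T (Tensor.pure x)|}

/-- For `n ≥ 1` the supremum in the definition of the spectral norm is a maximum. -/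
theorem Tensor.spectralNorm_isGreatest {d n : ℕ} (hn : 1 ≤ n) (T : Tensor d n) :
    IsGreatest {r : ℝ | ∃ x : Fin d → EuclideanSpace ℝ (Fin n),
      (∀ j, ‖x j‖ = 1) ∧ r = |Tensor.inner T (Tensor.pure x)|} T.spectralNorm := by
  have hK : IsCompact (Set.univ.pi fun _ : Fin d =>
      Metric.sphere (0 : EuclideanSpace ℝ (Fin n)) 1) :=
    isCompact_univ_pi fun _ => isCompact_sphere _ _
  have hc : Continuous fun x : Fin d → EuclideanSpace ℝ (Fin n) =>
      |Tensor.inner T (Tensor.pure x)| := by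
    unfold Tensor.inner Tensor.pure
    fun_prop
  have heq : {r : ℝ | ∃ x : Fin d → EuclideanSpace ℝ (Fin n),
      (∀ j, ‖x j‖ = 1) ∧ r = |Tensor.inner T (Tensor.pure x)|} =
      (fun x : Fin d → EuclideanSpace ℝ (Fin n) => |Tensor.inner T (Tensor.pure x)|) ''
        (Set.univ.pi fun _ : Fin d => Metric.sphere (0 : EuclideanSpace ℝ (Fin n)) 1) := by
    ext r
    simp [Set.mem_pi, eq_comm]
  unfold Tensor.spectralNorm
  rw [heq]
  refine (hK.image hc).isGreatest_sSup (Set.Nonempty.image _ ?_)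
  exact ⟨fun _ => EuclideanSpace.single ⟨0, hn⟩ 1, by simp [Set.mem_pi]⟩

/-- A tensor is symmetric if its entries do not change when the indices are permuted. -/
def Tensor.IsSymm {d n : ℕ} (T : Tensor d n) : Prop :=
  ∀ (s : Equiv.Perm (Fin d)) (i : Fin d → Fin n), T (i ∘ s) = T i

/-- The exponent vector of `x_{i_1} ⋯ x_{i_d}`: its value at `m` is the number of times that `m`
appears among `i_1, …, i_d`. -/
def expo {d n : ℕ} (i : Fin d → Fin n) : Fin n →₀ ℕ := ∑ j, Finsupp.single (i j) 1

/-- The symmetric tensor of a homogeneous polynomial `f` of degree `d` in `n` variables, that is,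
the unique symmetric tensor `F` with `f(x) = ⟨F, x ⊗ ⋯ ⊗ x⟩`
(see `tensorOf_isSymm`, `eval_eq_inner_tensorOf` and `tensorOf_unique`): the entry `F_{i_1, …, i_d}`
is the coefficient of `x_{i_1} ⋯ x_{i_d}` in `f`, divided by the multinomial coefficient. -/
def tensorOf {n : ℕ} (d : ℕ) (f : MvPolynomial (Fin n) ℝ) : Tensor d n :=
  fun i => f.coeff (expo i) / ((expo i).multinomial : ℝ)

/-- The Hilbert-Schmidt norm of a homogeneous polynomial of degree `d`. -/
def hsNorm {n : ℕ} (d : ℕ) (f : MvPolynomial (Fin n) ℝ) : ℝ := (tensorOf d f).hsNorm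

/-- The spectral norm of a homogeneous polynomial of degree `d`. -/
def spectralNorm {n : ℕ} (d : ℕ) (f : MvPolynomial (Fin n) ℝ) : ℝ := (tensorOf d f).spectralNorm

/-- The linear form `cᵀ x` as a polynomial. -/
def linForm {n : ℕ} (c : EuclideanSpace ℝ (Fin n)) : MvPolynomial (Fin n) ℝ :=
  ∑ i, MvPolynomial.C (c i) * MvPolynomial.X i

theorem tensorOf_isSymm {n d : ℕ} (f : MvPolynomial (Fin n) ℝ) : (tensorOf d f).IsSymm := by
  intro s i
  have h : expo (i ∘ s) = expo i := by
    unfold expo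
    exact Equiv.sum_comp s (fun j => Finsupp.single (i j) 1)
  simp [tensorOf, h]

theorem prod_X_eq {n d : ℕ} (i : Fin d → Fin n) :
    (∏ j, MvPolynomial.X (i j) : MvPolynomial (Fin n) ℝ) = MvPolynomial.monomial (expo i) 1 := by
  unfold expo
  rw [MvPolynomial.monomial_sum_one]
  rfl

theorem expo_degree {n d : ℕ} (i : Fin d → Fin n) : (expo i).degree = d := by
  simp [expo, map_sum]

theorem card_expo {n d : ℕ} (m : Fin n →₀ ℕ) (hm : m.degree = d) :
    ((Finset.univ.filter (fun i : Fin d → Fin n => expo i = m)).card : ℝ) = m.multinomial := by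
  have h1 : ((∑ a : Fin n, MvPolynomial.X a : MvPolynomial (Fin n) ℝ) ^ d).coeff m
      = ((Finset.univ.filter (fun i : Fin d → Fin n => expo i = m)).card : ℝ) := by
    rw [Fintype.sum_pow]
    simp [prod_X_eq, MvPolynomial.coeff_sum, MvPolynomial.coeff_monomial]
  rw [← h1, MvPolynomial.coeff_sum_X_pow_of_fintype, if_pos]
  · rw [Finsupp.sum_fintype _ _ (by simp), ← hm, Finsupp.degree_eq_sum]

theorem multinomial_expo_ne_zero {n d : ℕ} (i : Fin d → Fin n) :
    ((expo i).multinomial : ℝ) ≠ 0 := by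
  rw [← card_expo (expo i) (expo_degree i)]
  exact_mod_cast Finset.card_ne_zero_of_mem (a := i) (by simp)

theorem sum_tensorOf_eq {n d : ℕ} {f : MvPolynomial (Fin n) ℝ} (hf : f.IsHomogeneous d) :
    (∑ i : Fin d → Fin n, MvPolynomial.monomial (expo i) (tensorOf d f i)) = f := by
  ext m
  rw [MvPolynomial.coeff_sum]
  simp only [MvPolynomial.coeff_monomial]
  rw [← Finset.sum_filter]
  by_cases hm : m.degree = d
  · rw [Finset.sum_congr rfl (g := fun _ => f.coeff m / (m.multinomial : ℝ))]
    · rw [Finset.sum_const, nsmul_eq_mul, card_expo m hm]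
      obtain h | h := Finset.eq_empty_or_nonempty
        (Finset.univ.filter (fun i : Fin d → Fin n => expo i = m))
      · have h2 := card_expo m hm
        rw [h] at h2
        have h3 : (Finsupp.multinomial m) ≠ 0 := by
          rw [Finsupp.multinomial_eq]
          exact (Nat.multinomial_pos _ _).ne'
        simp at h2
        exact absurd h2.symm (by exact_mod_cast h3)
      · obtain ⟨i, hi⟩ := h
        have hi : expo i = m := by simpa using hi
        have := multinomial_expo_ne_zero i
        rw [hi] at this
        field_simp
    · intro i hi
      have hi : expo i = m := by simpa using hi
      simp [tensorOf, hi]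
  · rw [hf.coeff_eq_zero hm]
    refine Finset.sum_eq_zero fun i hi => absurd ?_ hm
    have hi : expo i = m := by simpa using hi
    rw [← hi, expo_degree]

theorem eval_monomial_expo {n d : ℕ} (i : Fin d → Fin n) (a : ℝ) (x : EuclideanSpace ℝ (Fin n)) :
    (MvPolynomial.monomial (expo i) a).eval (fun m => x m)
      = a * Tensor.pure (fun _ : Fin d => x) i := by
  have h : MvPolynomial.monomial (expo i) a
      = MvPolynomial.C a * ∏ j, MvPolynomial.X (i j) := by
    rw [prod_X_eq, MvPolynomial.C_mul_monomial, mul_one]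
  rw [h]
  simp [Tensor.pure]

theorem eval_eq_inner_tensorOf {n d : ℕ} {f : MvPolynomial (Fin n) ℝ} (hf : f.IsHomogeneous d)
    (x : EuclideanSpace ℝ (Fin n)) :
    f.eval (fun m => x m) = Tensor.inner (tensorOf d f) (Tensor.pure fun _ => x) := by
  conv_lhs => rw [← sum_tensorOf_eq hf]
  simp only [map_sum, eval_monomial_expo, Tensor.inner]

theorem expo_apply {n d : ℕ} (i : Fin d → Fin n) (m : Fin n) :
    expo i m = Fintype.card {j // i j = m} := by
  simp [expo, Finsupp.single_apply, Fintype.card_subtype]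

theorem exists_perm_of_expo_eq {n d : ℕ} {i i' : Fin d → Fin n} (h : expo i = expo i') :
    ∃ s : Equiv.Perm (Fin d), i' ∘ s = i := by
  have e : ∀ m, Nonempty ({j // i j = m} ≃ {j // i' j = m}) := fun m =>
    ⟨Fintype.equivOfCardEq (by rw [← expo_apply, ← expo_apply, h])⟩
  exact ⟨Equiv.ofFiberEquiv fun m => (e m).some,
    funext fun j => Equiv.ofFiberEquiv_map _ j⟩

theorem tensorOf_unique {n d : ℕ} {f : MvPolynomial (Fin n) ℝ} {T : Tensor d n}
    (hT : T.IsSymm) (h : ∀ x : EuclideanSpace ℝ (Fin n),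
      f.eval (fun m => x m) = Tensor.inner T (Tensor.pure fun _ => x)) :
    T = tensorOf d f := by
  have hf : f = ∑ i : Fin d → Fin n, MvPolynomial.monomial (expo i) (T i) := by
    refine MvPolynomial.funext fun x => ?_
    have := h (WithLp.toLp 2 x)
    simp only [Tensor.inner, ← eval_monomial_expo] at this
    simpa [map_sum] using this
  funext i
  rw [tensorOf, eq_div_iff (multinomial_expo_ne_zero i), hf, MvPolynomial.coeff_sum]
  simp only [MvPolynomial.coeff_monomial]
  rw [← Finset.sum_filter, Finset.sum_congr rfl (g := fun _ => T i)]
  · rw [Finset.sum_const, nsmul_eq_mul, card_expo _ (expo_degree i), mul_comm]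
  · intro j hj
    obtain ⟨s, rfl⟩ := exists_perm_of_expo_eq (by simpa using hj)
    exact hT s i

end PolyNorm

end

namespace PolyNorm

/-! The tensor of a product `f * g` is the symmetrisation of the outer product of the two tensors.
Outer products multiply Hilbert-Schmidt norms and symmetrisation is an orthogonal projection, so the
norm is submultiplicative. Equality forces the outer product itself to be symmetric. Exchanging
modes between its factors then shows that the tensor of `f ^ k` is a multiple of a power of a vector
(`Tensor.eq_smul_pure_of_outer_isSymm`). As linear forms are prime, unique factorisation passes this
from `f ^ k` to `f`.

By Banach's theorem the spectral norm of `f` is `|f(x)|` for some unit vector `x`. Its `k`-th power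
is thus the absolute value of the pairing of the tensor of `f ^ k` with a unit rank one tensor, and
Cauchy-Schwarz with its equality case gives the comparison of the two norms.

The limit comes from Fekete's lemma. It lies strictly below every term because passing from `k` to
`2 * k` already strictly decreases the `k`-th root. -/

variable {n d e : ℕ}

/-! ### The multilinear form of a tensor and Banach's theorem -/

/-- The multilinear form `(x_1, …, x_d) ↦ ⟨T, x_1 ⊗ ⋯ ⊗ x_d⟩` of a tensor. -/
noncomputable def Tensor.form (T : Tensor d n) :
    MultilinearMap ℝ (fun _ : Fin d => EuclideanSpace ℝ (Fin n)) ℝ :=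
  ∑ i, T i • (MultilinearMap.mkPiAlgebra ℝ (Fin d) ℝ).compLinearMap
    (fun j => (EuclideanSpace.proj (i j) : EuclideanSpace ℝ (Fin n) →L[ℝ] ℝ).toLinearMap)

theorem Tensor.form_apply (T : Tensor d n) (x : Fin d → EuclideanSpace ℝ (Fin n)) :
    T.form x = Tensor.inner T (Tensor.pure x) := by
  simp [Tensor.form, Tensor.inner, Tensor.pure]

theorem Tensor.continuous_form (T : Tensor d n) : Continuous T.form := by
  have : (T.form : (Fin d → EuclideanSpace ℝ (Fin n)) → ℝ) =
      fun x => ∑ i, T i * ∏ j, x j (i j) := by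
    funext x
    rw [T.form_apply]
    rfl
  rw [this]
  fun_prop

theorem Tensor.IsSymm.form_comp {T : Tensor d n} (hT : T.IsSymm) (s : Equiv.Perm (Fin d))
    (x : Fin d → EuclideanSpace ℝ (Fin n)) : T.form (x ∘ s) = T.form x := by
  rw [T.form_apply, T.form_apply]
  unfold Tensor.inner Tensor.pure
  rw [← Equiv.sum_comp (s.symm.arrowCongr (Equiv.refl (Fin n)))]
  refine Finset.sum_congr rfl fun i _ => ?_
  have h : (s.symm.arrowCongr (Equiv.refl (Fin n))) i = i ∘ s := rfl
  rw [h, hT s i, ← Equiv.prod_comp s (fun j => x j (i j))]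
  rfl

theorem Tensor.abs_form_le_of_norm_eq_one (hn : 1 ≤ n) (T : Tensor d n)
    {x : Fin d → EuclideanSpace ℝ (Fin n)} (hx : ∀ j, ‖x j‖ = 1) :
    |T.form x| ≤ T.spectralNorm :=
  (T.spectralNorm_isGreatest hn).2 ⟨x, hx, by rw [T.form_apply]⟩

theorem Tensor.spectralNorm_nonneg (T : Tensor d n) : 0 ≤ T.spectralNorm :=
  Real.sSup_nonneg fun _ ⟨_, _, hr⟩ => hr ▸ abs_nonneg _

theorem Tensor.abs_form_le (hn : 1 ≤ n) (T : Tensor d n)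
    (x : Fin d → EuclideanSpace ℝ (Fin n)) :
    |T.form x| ≤ T.spectralNorm * ∏ j, ‖x j‖ := by
  by_cases h : ∃ j, x j = 0
  · obtain ⟨j, hj⟩ := h
    rw [T.form.map_coord_zero j hj, abs_zero]
    exact mul_nonneg T.spectralNorm_nonneg (Finset.prod_nonneg fun _ _ => norm_nonneg _)
  · push Not at h
    have hx : x = fun j => ‖x j‖ • (‖x j‖⁻¹ • x j) := by
      funext j
      rw [smul_smul, mul_inv_cancel₀ (norm_ne_zero_iff.2 (h j)), one_smul]
    have h1 : |T.form fun j => ‖x j‖⁻¹ • x j| ≤ T.spectralNorm :=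
      T.abs_form_le_of_norm_eq_one hn fun j => by
        rw [norm_smul, norm_inv, norm_norm, inv_mul_cancel₀ (norm_ne_zero_iff.2 (h j))]
    have h2 : 0 ≤ ∏ j, ‖x j‖ := Finset.prod_nonneg fun _ _ => norm_nonneg _
    calc |T.form x| = (∏ j, ‖x j‖) * |T.form fun j => ‖x j‖⁻¹ • x j| := by
          conv_lhs => rw [hx, T.form.map_smul_univ]
          rw [smul_eq_mul, abs_mul, abs_of_nonneg h2]
      _ ≤ T.spectralNorm * ∏ j, ‖x j‖ := by
          rw [mul_comm]
          gcongr

theorem prod_norm_update_update {x : Fin d → EuclideanSpace ℝ (Fin n)} (hx : ∀ j, ‖x j‖ = 1)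
    {j k : Fin d} (hjk : j ≠ k) (v w : EuclideanSpace ℝ (Fin n)) :
    ∏ i, ‖Function.update (Function.update x j v) k w i‖ = ‖v‖ * ‖w‖ := by
  rw [Fintype.prod_eq_mul j k hjk]
  · simp [hjk]
  · rintro i ⟨hj, hk⟩
    simp [hj, hk, hx]

/-- Averaging two arguments of a maximiser of a symmetric form gives a maximiser. -/
theorem Tensor.IsSymm.spectralNorm_le_abs_form_update (hn : 1 ≤ n) {T : Tensor d n}
    (hT : T.IsSymm) {x : Fin d → EuclideanSpace ℝ (Fin n)} (hx : ∀ j, ‖x j‖ = 1)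
    (hmax : |T.form x| = T.spectralNorm)
    {j k : Fin d} (hjk : j ≠ k) {u : EuclideanSpace ℝ (Fin n)}
    (hu : x j + x k = ‖x j + x k‖ • u)
    (h0 : x j + x k ≠ 0) :
    T.spectralNorm ≤ |T.form (Function.update (Function.update x j u) k u)| := by
  set M := T.spectralNorm
  set B : EuclideanSpace ℝ (Fin n) → EuclideanSpace ℝ (Fin n) → ℝ := fun v w =>
    T.form (Function.update (Function.update x j v) k w) with hB
  have Bx : B (x j) (x k) = T.form x := by simp [hB]
  have Bsymm : ∀ v w, B v w = B w v := fun v w => by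
    simp only [hB]
    rw [← hT.form_comp (Equiv.swap j k)]
    congr 1
    funext i
    by_cases h1 : i = j
    · subst h1; simp [hjk]
    · by_cases h2 : i = k
      · subst h2; simp [hjk]
      · simp [Equiv.swap_apply_of_ne_of_ne h1 h2, h1, h2]
  have Badd_right : ∀ v w w', B v (w + w') = B v w + B v w' := fun v w w' => by
    simp [hB]
  have Bsmul_right : ∀ (c : ℝ) v w, B v (c • w) = c * B v w := fun c v w => by
    simp [hB]
  have Badd_left : ∀ v v' w, B (v + v') w = B v w + B v' w := fun v v' w => by
    rw [Bsymm, Badd_right, Bsymm w v, Bsymm w v']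
  have Bsmul_left : ∀ (c : ℝ) v w, B (c • v) w = c * B v w := fun c v w => by
    rw [Bsymm, Bsmul_right, Bsymm w v]
  have Bbound : ∀ v w, |B v w| ≤ M * (‖v‖ * ‖w‖) := fun v w => by
    rw [← prod_norm_update_update hx hjk v w]
    exact T.abs_form_le hn _
  -- Polarisation. The difference vector contributes at most `M * ‖x j - x k‖ ^ 2`, and the
  -- parallelogram law `‖x j + x k‖ ^ 2 + ‖x j - x k‖ ^ 2 = 4` leaves at least `M * ‖x j + x k‖ ^ 2`
  -- for the sum vector.
  have hpol : B (x j + x k) (x j + x k) - B (x j + (-1 : ℝ) • x k) (x j + (-1 : ℝ) • x k)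
      = 4 * T.form x := by
    simp only [Badd_left, Badd_right, Bsmul_left, Bsmul_right, Bsymm (x k) (x j), Bx]
    ring
  have hpar := parallelogram_law_with_norm ℝ (x j) (x k)
  rw [hx, hx] at hpar
  have hminus := Bbound (x j + (-1 : ℝ) • x k) (x j + (-1 : ℝ) • x k)
  rw [neg_one_smul, ← sub_eq_add_neg] at hpol hminus
  have h4 : 4 * M ≤ |B (x j + x k) (x j + x k)| + |B (x j - x k) (x j - x k)| := by
    calc 4 * M = |4 * T.form x| := by rw [abs_mul, hmax]; norm_num
      _ ≤ _ := by rw [← hpol]; exact abs_sub _ _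
  have hplus : M * (‖x j + x k‖ * ‖x j + x k‖) ≤ |B (x j + x k) (x j + x k)| := by
    linear_combination h4 + hminus + M * hpar
  have hpos : 0 < ‖x j + x k‖ * ‖x j + x k‖ := by
    have := norm_pos_iff.2 h0
    positivity
  have hBu : |B (x j + x k) (x j + x k)| = |B u u| * (‖x j + x k‖ * ‖x j + x k‖) := by
    have : B (x j + x k) (x j + x k) = ‖x j + x k‖ * (‖x j + x k‖ * B u u) := by
      rw [← Bsmul_right, ← Bsmul_left, ← hu]
    rw [this, ← mul_assoc, abs_mul, abs_of_pos hpos, mul_comm]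
  rw [hBu] at hplus
  exact le_of_mul_le_mul_right hplus hpos

/-- **Banach's theorem**: the spectral norm of a symmetric tensor is attained on the diagonal. -/
theorem Tensor.IsSymm.exists_spectralNorm_eq (hn : 1 ≤ n) (hd : 1 ≤ d) {T : Tensor d n}
    (hT : T.IsSymm) : ∃ x : EuclideanSpace ℝ (Fin n), ‖x‖ = 1 ∧
      T.spectralNorm = |Tensor.inner T (Tensor.pure fun _ => x)| := by
  obtain ⟨x₀, hx₀, hM⟩ := (T.spectralNorm_isGreatest hn).1
  rw [← T.form_apply] at hM
  set v : EuclideanSpace ℝ (Fin n) := x₀ ⟨0, hd⟩ with hv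
  set K : Set (Fin d → EuclideanSpace ℝ (Fin n)) :=
    {x | (∀ j, ‖x j‖ = 1) ∧ |T.form x| = T.spectralNorm} with hK
  have hKc : IsCompact K := by
    have h1 : IsCompact (Set.univ.pi fun _ : Fin d =>
        Metric.sphere (0 : EuclideanSpace ℝ (Fin n)) 1) :=
      isCompact_univ_pi fun _ => isCompact_sphere _ _
    have h2 : IsClosed {x : Fin d → EuclideanSpace ℝ (Fin n) | |T.form x| = T.spectralNorm} :=
      isClosed_eq T.continuous_form.abs continuous_const
    convert! h1.inter_right h2 using 1
    ext x
    simp [hK, Set.mem_pi]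
  -- Among all maximisers, one most aligned with the fixed vector `v` is selected; averaging two of
  -- its arguments would increase `φ` unless they already coincide.
  set φ : (Fin d → EuclideanSpace ℝ (Fin n)) → ℝ :=
    fun x => ∑ j, |Inner.inner ℝ v (x j)| with hφ
  have hφc : Continuous φ := by
    simp only [hφ]
    fun_prop
  obtain ⟨x₁, hx₁, hx₁max⟩ := hKc.exists_isMaxOn ⟨x₀, hx₀, hM.symm⟩ hφc.continuousOn
  -- Sign changes affect neither `|T.form x|` nor `φ`, so all inner products with `v` may be taken
  -- nonnegative.
  set ε : Fin d → ℝ := fun j => if Inner.inner ℝ v (x₁ j) < 0 then -1 else 1 with hε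
  have hεabs : ∀ j, |ε j| = 1 := fun j => by
    simp only [hε]
    split_ifs <;> simp
  set x : Fin d → EuclideanSpace ℝ (Fin n) := fun j => ε j • x₁ j with hxdef
  have hx1 : ∀ j, ‖x j‖ = 1 := fun j => by
    simp only [hxdef]
    rw [norm_smul, Real.norm_eq_abs, hεabs, hx₁.1, mul_one]
  have hxM : |T.form x| = T.spectralNorm := by
    rw [hxdef, T.form.map_smul_univ, smul_eq_mul, abs_mul, Finset.abs_prod, hx₁.2]
    simp [hεabs]
  have hinner : ∀ j, Inner.inner ℝ v (x j) = |Inner.inner ℝ v (x₁ j)| := fun j => by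
    simp only [hxdef, hε, inner_smul_right]
    split_ifs with h
    · rw [abs_of_neg h]; ring
    · rw [abs_of_nonneg (not_lt.1 h)]; ring
  have hnonneg : ∀ j, 0 ≤ Inner.inner ℝ v (x j) := fun j => by
    rw [hinner]; exact abs_nonneg _
  have hφx : φ x = φ x₁ := by
    simp only [hφ, hinner, abs_abs]
  -- The maximal value of `φ` is positive, since `v` is an argument of the maximiser `x₀` and
  -- contributes `1` there.
  obtain ⟨j, hj⟩ : ∃ j, 0 < Inner.inner ℝ v (x j) := by
    by_contra! hcon
    have h1 : φ x ≤ 0 := Finset.sum_nonpos fun j _ => by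
      rw [abs_of_nonneg (hnonneg j)]; exact hcon j
    have h2 : φ x₀ ≤ φ x := hφx ▸ hx₁max ⟨hx₀, hM.symm⟩
    have h3 : |Inner.inner ℝ v v| ≤ φ x₀ :=
      Finset.single_le_sum (f := fun j => |Inner.inner ℝ v (x₀ j)|)
        (fun _ _ => abs_nonneg _) (Finset.mem_univ (⟨0, hd⟩ : Fin d))
    rw [real_inner_self_eq_norm_sq, hv, hx₀] at h3
    norm_num at h3
    linarith
  have hall : ∀ k, x k = x j := fun k => by
    by_cases hjk : j = k
    · rw [hjk]
    have hs : 0 < Inner.inner ℝ v (x j + x k) := by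
      rw [inner_add_right]
      linarith [hnonneg k]
    have h0 : x j + x k ≠ 0 := fun h => by simp [h] at hs
    have hpos : 0 < ‖x j + x k‖ := norm_pos_iff.2 h0
    set u : EuclideanSpace ℝ (Fin n) := ‖x j + x k‖⁻¹ • (x j + x k) with hu
    have hu1 : ‖u‖ = 1 := by
      rw [hu, norm_smul, norm_inv, norm_norm, inv_mul_cancel₀ hpos.ne']
    set y := Function.update (Function.update x j u) k u with hy
    have hy1 : ∀ i, ‖y i‖ = 1 := fun i => by
      by_cases hik : i = k
      · subst hik; simp [hy, hu1]
      · by_cases hij : i = j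
        · subst hij; simp [hy, hik, hu1]
        · simp [hy, hik, hij, hx1]
    have hyM : |T.form y| = T.spectralNorm := by
      refine le_antisymm (T.abs_form_le_of_norm_eq_one hn hy1) ?_
      refine hT.spectralNorm_le_abs_form_update hn hx1 hxM hjk ?_ h0
      rw [hu, smul_smul, mul_inv_cancel₀ hpos.ne', one_smul]
    have hle : φ y ≤ φ x := hφx ▸ hx₁max ⟨hy1, hyM⟩
    -- The change of `φ` is `(2 / ‖x j + x k‖ - 1)` times a positive number. Maximality gives `‖x j
    -- + x k‖ ≥ 2`, which for unit vectors forces equality of the two.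
    have hdiff : φ y - φ x = 2 * Inner.inner ℝ v u - Inner.inner ℝ v (x j + x k) := by
      have hvu : 0 ≤ Inner.inner ℝ v u := by
        rw [hu, inner_smul_right]; positivity
      simp only [hφ]
      rw [← Finset.sum_sub_distrib, Fintype.sum_eq_add j k hjk]
      · simp only [hy, Function.update_self, Function.update_of_ne hjk, abs_of_nonneg hvu,
          abs_of_nonneg (hnonneg _), inner_add_right]
        ring
      · rintro i ⟨hij, hik⟩
        simp [hy, hij, hik]
    rw [hu, inner_smul_right] at hdiff
    have h2 : 2 * ‖x j + x k‖⁻¹ ≤ 1 := by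
      by_contra! hcon
      nlinarith
    have h3 : 2 ≤ ‖x j + x k‖ := by
      rw [← div_eq_mul_inv, div_le_one hpos] at h2
      exact h2
    have hpar := parallelogram_law_with_norm ℝ (x j) (x k)
    rw [hx1, hx1] at hpar
    have h4 : ‖x j - x k‖ = 0 := by
      have : ‖x j - x k‖ * ‖x j - x k‖ ≤ 0 := by nlinarith
      exact mul_self_eq_zero.1 (le_antisymm this (mul_self_nonneg _))
    exact (sub_eq_zero.1 (norm_eq_zero.1 h4)).symm
  refine ⟨x j, hx1 j, ?_⟩
  rw [← T.form_apply, ← hxM]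
  congr 2
  funext k
  exact hall k

/-! ### Inner products of tensors and tensors of powers of linear forms -/

theorem Tensor.inner_comm (S T : Tensor d n) : Tensor.inner S T = Tensor.inner T S :=
  Finset.sum_congr rfl fun _ _ => mul_comm _ _

theorem Tensor.inner_self_nonneg (T : Tensor d n) : 0 ≤ Tensor.inner T T :=
  Finset.sum_nonneg fun _ _ => mul_self_nonneg _

theorem Tensor.inner_self_eq_zero {T : Tensor d n} (h : Tensor.inner T T = 0) : T = 0 := by
  funext i
  have := (Finset.sum_eq_zero_iff_of_nonneg fun i _ => mul_self_nonneg (T i)).1 h i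
    (Finset.mem_univ i)
  exact mul_self_eq_zero.1 this

theorem Tensor.hsNorm_nonneg (T : Tensor d n) : 0 ≤ T.hsNorm := Real.sqrt_nonneg _

theorem Tensor.hsNorm_sq (T : Tensor d n) : T.hsNorm ^ 2 = Tensor.inner T T :=
  Real.sq_sqrt T.inner_self_nonneg

theorem Tensor.inner_sub_smul_self (S T : Tensor d n) (c : ℝ) :
    Tensor.inner (S - c • T) (S - c • T)
      = Tensor.inner S S - 2 * c * Tensor.inner S T + c ^ 2 * Tensor.inner T T := by
  simp only [Tensor.inner, Finset.mul_sum, ← Finset.sum_sub_distrib, ← Finset.sum_add_distrib]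
  refine Finset.sum_congr rfl fun i _ => ?_
  simp
  ring

theorem Tensor.inner_smul_left (a : ℝ) (S T : Tensor d n) :
    Tensor.inner (a • S) T = a * Tensor.inner S T := by
  simp [Tensor.inner, Finset.mul_sum, mul_assoc]

theorem Tensor.inner_pure_pure (x y : Fin d → EuclideanSpace ℝ (Fin n)) :
    Tensor.inner (Tensor.pure x) (Tensor.pure y) = ∏ j, Inner.inner ℝ (x j) (y j) := by
  simp only [Tensor.inner, Tensor.pure, PiLp.inner_apply, ← Finset.prod_mul_distrib]
  rw [Finset.prod_univ_sum, Fintype.piFinset_univ]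
  simp [mul_comm]

theorem eval_linForm (c x : EuclideanSpace ℝ (Fin n)) :
    (linForm c).eval (fun m => x m) = Inner.inner ℝ c x := by
  simp [linForm, PiLp.inner_apply, mul_comm]

theorem inner_smul_pure_const (a : ℝ) (c x : EuclideanSpace ℝ (Fin n)) :
    Tensor.inner (a • Tensor.pure fun _ : Fin d => c) (Tensor.pure fun _ => x)
      = (MvPolynomial.C a * linForm c ^ d).eval (fun m => x m) := by
  rw [Tensor.inner_smul_left, Tensor.inner_pure_pure]
  simp [eval_linForm]

theorem tensorOf_linForm_pow (a : ℝ) (c : EuclideanSpace ℝ (Fin n)) :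
    tensorOf d (MvPolynomial.C a * linForm c ^ d) = a • Tensor.pure fun _ : Fin d => c := by
  refine (tensorOf_unique ?_ fun x => (inner_smul_pure_const a c x).symm).symm
  intro s i
  simp only [Pi.smul_apply, Tensor.pure, Function.comp_apply]
  rw [Equiv.prod_comp s (fun j => c (i j))]

theorem eq_linForm_pow_of_tensorOf_eq {g : MvPolynomial (Fin n) ℝ} (hg : g.IsHomogeneous d)
    {a : ℝ} {c : EuclideanSpace ℝ (Fin n)}
    (h : tensorOf d g = a • Tensor.pure fun _ : Fin d => c) :
    g = MvPolynomial.C a * linForm c ^ d := by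
  refine MvPolynomial.funext fun x => ?_
  have h1 := eval_eq_inner_tensorOf hg (WithLp.toLp 2 x)
  rw [h, inner_smul_pure_const] at h1
  exact h1

theorem tensorOf_ne_zero {g : MvPolynomial (Fin n) ℝ} (hg : g.IsHomogeneous d) (h0 : g ≠ 0) :
    tensorOf d g ≠ 0 := by
  intro h
  apply h0
  rw [← sum_tensorOf_eq hg, h]
  simp

theorem hsNorm_nonneg (f : MvPolynomial (Fin n) ℝ) : 0 ≤ hsNorm d f := Tensor.hsNorm_nonneg _

/-! ### Norms of powers of linear forms -/

theorem Tensor.hsNorm_smul_pure_const (a : ℝ) (c : EuclideanSpace ℝ (Fin n)) :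
    Tensor.hsNorm (a • Tensor.pure fun _ : Fin d => c) = |a| * ‖c‖ ^ d := by
  rw [Tensor.hsNorm, Tensor.inner_smul_left, Tensor.inner_comm, Tensor.inner_smul_left,
    Tensor.inner_pure_pure]
  rw [Finset.prod_const, Finset.card_univ, Fintype.card_fin, real_inner_self_eq_norm_sq]
  rw [show a * (a * (‖c‖ ^ 2) ^ d) = (a * ‖c‖ ^ d) ^ 2 by ring, Real.sqrt_sq_eq_abs, abs_mul,
    abs_pow, abs_norm]

/-- Cauchy-Schwarz in each mode gives the bound, attained when every argument is `c / ‖c‖`. -/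
theorem Tensor.spectralNorm_smul_pure_const (a : ℝ) {c : EuclideanSpace ℝ (Fin n)} (hc : c ≠ 0) :
    Tensor.spectralNorm (a • Tensor.pure fun _ : Fin d => c) = |a| * ‖c‖ ^ d := by
  refine IsGreatest.csSup_eq ⟨⟨fun _ => ‖c‖⁻¹ • c, fun _ => ?_, ?_⟩, ?_⟩
  · rw [norm_smul, norm_inv, norm_norm, inv_mul_cancel₀ (norm_ne_zero_iff.2 hc)]
  · rw [Tensor.inner_smul_left, Tensor.inner_pure_pure, Finset.prod_const, Finset.card_univ,
      Fintype.card_fin, inner_smul_right, real_inner_self_eq_norm_sq, sq,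
      inv_mul_cancel_left₀ (norm_ne_zero_iff.2 hc), abs_mul, abs_pow, abs_norm]
  · rintro _ ⟨x, hx, rfl⟩
    rw [Tensor.inner_smul_left, Tensor.inner_pure_pure, abs_mul, Finset.abs_prod]
    gcongr
    calc ∏ j, |Inner.inner ℝ c (x j)| ≤ ∏ _j : Fin d, ‖c‖ := by
          refine Finset.prod_le_prod (fun _ _ => abs_nonneg _) fun j _ => ?_
          simpa [hx j] using abs_real_inner_le_norm c (x j)
      _ = ‖c‖ ^ d := by simp

/-! ### Products and symmetrisation -/

/-- The outer product of two tensors. -/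
def Tensor.outer (S : Tensor d n) (T : Tensor e n) : Tensor (d + e) n :=
  fun i => S (fun j => i (Fin.castAdd e j)) * T (fun j => i (Fin.natAdd d j))

theorem Tensor.outer_append (S : Tensor d n) (T : Tensor e n) (i : Fin d → Fin n)
    (j : Fin e → Fin n) : Tensor.outer S T (Fin.append i j) = S i * T j := by
  simp [Tensor.outer]

theorem Tensor.inner_outer_outer (S S' : Tensor d n) (T T' : Tensor e n) :
    Tensor.inner (Tensor.outer S T) (Tensor.outer S' T')
      = Tensor.inner S S' * Tensor.inner T T' := by
  unfold Tensor.inner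
  rw [← Equiv.sum_comp (Fin.appendEquiv d e)
    (fun i => Tensor.outer S T i * Tensor.outer S' T' i), Fintype.sum_prod_type,
    Finset.sum_mul_sum]
  refine Finset.sum_congr rfl fun i _ => Finset.sum_congr rfl fun j _ => ?_
  change Tensor.outer S T (Fin.append i j) * Tensor.outer S' T' (Fin.append i j) = _
  rw [Tensor.outer_append, Tensor.outer_append]
  ring

theorem Tensor.pure_const_add (x : EuclideanSpace ℝ (Fin n)) :
    (Tensor.pure fun _ : Fin (d + e) => x)
      = Tensor.outer (Tensor.pure fun _ : Fin d => x) (Tensor.pure fun _ : Fin e => x) := by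
  funext i
  simp [Tensor.pure, Tensor.outer, Fin.prod_univ_add]

theorem Tensor.hsNorm_outer (S : Tensor d n) (T : Tensor e n) :
    (Tensor.outer S T).hsNorm = S.hsNorm * T.hsNorm := by
  rw [Tensor.hsNorm, Tensor.inner_outer_outer, Real.sqrt_mul S.inner_self_nonneg]
  rfl

/-- The average of a tensor over all permutations of its modes. -/
noncomputable def Tensor.symmetrize (T : Tensor d n) : Tensor d n :=
  fun i => (d.factorial : ℝ)⁻¹ * ∑ s : Equiv.Perm (Fin d), T (i ∘ s)

theorem Tensor.symmetrize_isSymm (T : Tensor d n) : T.symmetrize.IsSymm := by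
  intro s i
  unfold Tensor.symmetrize
  congr 1
  exact Equiv.sum_comp (Equiv.mulLeft s) fun t : Equiv.Perm (Fin d) => T (i ∘ t)

/-- Reindexing moves each permutation from `T` to `S`, where symmetry absorbs it. -/
theorem Tensor.inner_symmetrize {S : Tensor d n} (hS : S.IsSymm) (T : Tensor d n) :
    Tensor.inner T.symmetrize S = Tensor.inner T S := by
  have h : ∀ s : Equiv.Perm (Fin d), ∑ i, T (i ∘ s) * S i = Tensor.inner T S := fun s => by
    unfold Tensor.inner
    rw [← Equiv.sum_comp (s.symm.arrowCongr (Equiv.refl (Fin n))) (fun i => T i * S i)]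
    refine Finset.sum_congr rfl fun i _ => ?_
    rw [← hS s i]
    rfl
  have h2 : Tensor.inner T.symmetrize S
      = (d.factorial : ℝ)⁻¹ * ∑ s : Equiv.Perm (Fin d), ∑ i, T (i ∘ s) * S i := by
    unfold Tensor.symmetrize Tensor.inner
    rw [Finset.sum_comm, Finset.mul_sum]
    refine Finset.sum_congr rfl fun i _ => ?_
    rw [mul_assoc, Finset.sum_mul]
  rw [h2]
  simp only [h, Finset.sum_const, Finset.card_univ, Fintype.card_perm, Fintype.card_fin,
    nsmul_eq_mul]
  rw [inv_mul_cancel_left₀ (by positivity)]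

theorem Tensor.pure_const_isSymm (x : EuclideanSpace ℝ (Fin n)) :
    (Tensor.pure fun _ : Fin d => x).IsSymm := by
  intro s i
  exact Equiv.prod_comp s (fun j => x (i j))

/-- Both sides are symmetric and represent the same polynomial on the diagonal, as symmetrising does
not change the pairing with `x ⊗ ⋯ ⊗ x`. -/
theorem tensorOf_mul {f g : MvPolynomial (Fin n) ℝ} (hf : f.IsHomogeneous d)
    (hg : g.IsHomogeneous e) :
    tensorOf (d + e) (f * g) = (Tensor.outer (tensorOf d f) (tensorOf e g)).symmetrize := by
  refine (tensorOf_unique (Tensor.symmetrize_isSymm _) fun x => ?_).symm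
  rw [Tensor.inner_symmetrize (Tensor.pure_const_isSymm x), Tensor.pure_const_add,
    Tensor.inner_outer_outer, map_mul, eval_eq_inner_tensorOf hf, eval_eq_inner_tensorOf hg]

/-- Symmetrisation is an orthogonal projection. -/
theorem Tensor.inner_sub_symmetrize_self (T : Tensor d n) :
    Tensor.inner (T - T.symmetrize) (T - T.symmetrize)
      = T.hsNorm ^ 2 - T.symmetrize.hsNorm ^ 2 := by
  have h := Tensor.inner_sub_smul_self T T.symmetrize 1
  rw [one_smul, ← Tensor.inner_symmetrize T.symmetrize_isSymm T] at h
  rw [h, Tensor.hsNorm_sq, Tensor.hsNorm_sq]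
  ring

theorem Tensor.hsNorm_symmetrize_le (T : Tensor d n) : T.symmetrize.hsNorm ≤ T.hsNorm := by
  refine le_of_sq_le_sq ?_ T.hsNorm_nonneg
  linarith [T.inner_sub_symmetrize_self, (T - T.symmetrize).inner_self_nonneg]

theorem Tensor.isSymm_of_hsNorm_le {T : Tensor d n} (h : T.hsNorm ≤ T.symmetrize.hsNorm) :
    T.IsSymm := by
  have h1 : Tensor.inner (T - T.symmetrize) (T - T.symmetrize) = 0 := by
    rw [T.inner_sub_symmetrize_self, le_antisymm h T.hsNorm_symmetrize_le, sub_self]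
  rw [sub_eq_zero.1 (Tensor.inner_self_eq_zero h1)]
  exact T.symmetrize_isSymm

theorem hsNorm_mul_le {f g : MvPolynomial (Fin n) ℝ} (hf : f.IsHomogeneous d)
    (hg : g.IsHomogeneous e) : hsNorm (d + e) (f * g) ≤ hsNorm d f * hsNorm e g := by
  unfold hsNorm
  rw [tensorOf_mul hf hg, ← Tensor.hsNorm_outer]
  exact Tensor.hsNorm_symmetrize_le _

/-- If the outer product of two nonzero tensors is symmetric, then the first factor is a multiple
of a power of a vector. -/
theorem Tensor.eq_smul_pure_of_outer_isSymm {S : Tensor d n} {T : Tensor e n} (he : 1 ≤ e)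
    (hT : T ≠ 0) (h : (Tensor.outer S T).IsSymm) :
    ∃ (a : ℝ) (c : EuclideanSpace ℝ (Fin n)), S = a • Tensor.pure fun _ : Fin d => c := by
  obtain ⟨t, ht⟩ := Function.ne_iff.1 hT
  rw [Pi.zero_apply] at ht
  set z : Fin e := ⟨0, he⟩
  set c : EuclideanSpace ℝ (Fin n) := WithLp.toLp 2 fun m => T (Function.update t z m) / T t with hc
  -- Exchanging mode `q` of `S` with mode `z` of `T` in the entry `S i * T t` replaces the index `i
  -- q` by `t z`, at the cost of the ratio `c (i q)`.
  have key : ∀ (i : Fin d → Fin n) (q : Fin d),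
      S i = c (i q) * S (Function.update i q (t z)) := by
    intro i q
    have h1 := h (Equiv.swap (Fin.castAdd e q) (Fin.natAdd d z)) (Fin.append i t)
    have h2 : Fin.append i t ∘ Equiv.swap (Fin.castAdd e q) (Fin.natAdd d z)
        = Fin.append (Function.update i q (t z)) (Function.update t z (i q)) := by
      have hne : ∀ (a : Fin d) (b : Fin e), Fin.castAdd e a ≠ Fin.natAdd d b := fun a b hab => by
        have := congrArg Fin.val hab
        simp at this
        have := a.isLt
        lia
      funext r
      refine Fin.addCases (fun r => ?_) (fun r => ?_) r
      · by_cases hr : r = q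
        · subst hr; simp
        · have hr' : Fin.castAdd e r ≠ Fin.castAdd e q := fun h => hr (Fin.castAdd_injective _ _ h)
          simp only [Function.comp_apply, Equiv.swap_apply_of_ne_of_ne hr' (hne r z),
            Fin.append_left, Function.update_of_ne hr]
      · by_cases hr : r = z
        · subst hr; simp
        · have hr' : Fin.natAdd d r ≠ Fin.natAdd d z := fun h => hr (Fin.natAdd_injective _ _ h)
          simp only [Function.comp_apply, Equiv.swap_apply_of_ne_of_ne (hne q r).symm hr',
            Fin.append_right, Function.update_of_ne hr]
    rw [h2, Tensor.outer_append, Tensor.outer_append] at h1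
    simp only [hc]
    field_simp
    linarith
  -- Iterating over the modes turns every index into `t z`, so `S i` is a product of the `c (i q)`
  -- times one constant.
  have hind : ∀ (s : Finset (Fin d)) (i : Fin d → Fin n),
      S i = (∏ q ∈ s, c (i q)) * S (s.piecewise (fun _ => t z) i) := by
    intro s i
    induction s using Finset.induction_on with
    | empty => simp
    | insert q s hq ih =>
      rw [Finset.prod_insert hq, Finset.piecewise_insert, ih, key (s.piecewise _ i) q,
        Finset.piecewise_eq_of_notMem _ _ _ hq]
      ring
  refine ⟨S fun _ => t z, c, funext fun i => ?_⟩
  rw [hind Finset.univ i, Finset.piecewise_univ, mul_comm]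
  rfl

/-! ### Powers proportional to powers of linear forms -/

theorem linForm_isHomogeneous (c : EuclideanSpace ℝ (Fin n)) : (linForm c).IsHomogeneous 1 := by
  refine MvPolynomial.IsHomogeneous.sum _ _ _ fun i _ => ?_
  simpa using (MvPolynomial.isHomogeneous_C (Fin n) (c i)).mul (MvPolynomial.isHomogeneous_X ℝ i)

theorem linForm_zero : linForm (0 : EuclideanSpace ℝ (Fin n)) = 0 := by
  simp [linForm]

theorem linForm_ne_zero {c : EuclideanSpace ℝ (Fin n)} (hc : c ≠ 0) : linForm c ≠ 0 := by
  intro h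
  have h1 := eval_linForm c c
  rw [h, map_zero] at h1
  exact hc (inner_self_eq_zero.1 h1.symm)

/-- A form of degree one is irreducible once its coefficients have only unit common divisors; over
`ℝ` this needs just one nonzero coefficient. -/
theorem linForm_irreducible {c : EuclideanSpace ℝ (Fin n)} (hc : c ≠ 0) :
    Irreducible (linForm c) := by
  refine MvPolynomial.irreducible_of_totalDegree_eq_one
    ((linForm_isHomogeneous c).totalDegree (linForm_ne_zero hc)) fun x hx => ?_
  refine isUnit_iff_ne_zero.2 ?_
  rintro rfl
  exact linForm_ne_zero hc (MvPolynomial.ext _ _ fun i => by simpa using hx i)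

/-- If a power of a nonzero form is a multiple of a power of a linear form, then so is the form
itself. -/
theorem exists_eq_linForm_pow_of_pow_eq {p k : ℕ} (hp : 1 ≤ p) (hk : 1 ≤ k)
    {f : MvPolynomial (Fin n) ℝ} (hf : f.IsHomogeneous p) (hf0 : f ≠ 0) {a : ℝ}
    {c : EuclideanSpace ℝ (Fin n)} (h : f ^ k = MvPolynomial.C a * linForm c ^ (k * p)) :
    ∃ (a : ℝ) (c : EuclideanSpace ℝ (Fin n)), a ≠ 0 ∧ c ≠ 0 ∧
      f = MvPolynomial.C a * linForm c ^ p := by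
  have hfk : f ^ k ≠ 0 := pow_ne_zero _ hf0
  have ha : a ≠ 0 := by
    rintro rfl
    exact hfk (by rw [h]; simp)
  have hc : c ≠ 0 := by
    rintro rfl
    refine hfk ?_
    rw [h, linForm_zero, zero_pow (by positivity), mul_zero]
  have hdvd : f ∣ linForm c ^ (k * p) := by
    have h1 : linForm c ^ (k * p) = MvPolynomial.C a⁻¹ * f ^ k := by
      rw [h, ← mul_assoc, ← MvPolynomial.C_mul, inv_mul_cancel₀ ha, MvPolynomial.C_1, one_mul]
    rw [h1]
    exact (dvd_pow_self f (by lia)).mul_left _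
  obtain ⟨i, -, hi⟩ := (dvd_prime_pow (linForm_irreducible hc).prime _).1 hdvd
  obtain ⟨u, hu⟩ := hi.symm
  obtain ⟨b, hb, hub⟩ := MvPolynomial.isUnit_iff_eq_C_of_isReduced.1 u.isUnit
  rw [hub, mul_comm] at hu
  -- Comparing degrees identifies the unknown exponent `i` with `p`.
  have hhom : f.IsHomogeneous i := by
    rw [← hu]
    simpa using (MvPolynomial.isHomogeneous_C (Fin n) b).mul ((linForm_isHomogeneous c).pow i)
  obtain rfl := hhom.inj_right hf hf0
  exact ⟨b, c, hb.ne_zero, hc, hu.symm⟩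

/-! ### Norm inequalities for powers of a form -/

theorem dim_pos_of_homogeneous {p : ℕ} (hp : 1 ≤ p) {f : MvPolynomial (Fin n) ℝ}
    (hf : f.IsHomogeneous p) (hf0 : f ≠ 0) : 1 ≤ n := by
  by_contra! h
  obtain rfl : n = 0 := by lia
  apply hf0
  ext m
  refine hf.coeff_eq_zero ?_
  rw [Subsingleton.elim m 0, map_zero]
  lia

theorem isHomogeneous_pow {p : ℕ} {f : MvPolynomial (Fin n) ℝ} (hf : f.IsHomogeneous p) (k : ℕ) :
    (f ^ k).IsHomogeneous (k * p) := by
  rw [mul_comm]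
  exact hf.pow k

/-- The norms of powers of a form that is a multiple of a power of a linear form. -/
theorem norms_pow_of_eq_linForm_pow {p : ℕ} (k : ℕ) {f : MvPolynomial (Fin n) ℝ} {a : ℝ}
    {c : EuclideanSpace ℝ (Fin n)} (hc : c ≠ 0) (h : f = MvPolynomial.C a * linForm c ^ p) :
    hsNorm (k * p) (f ^ k) = |a| ^ k * ‖c‖ ^ (k * p) ∧
      spectralNorm (k * p) (f ^ k) = |a| ^ k * ‖c‖ ^ (k * p) := by
  have hfk : f ^ k = MvPolynomial.C (a ^ k) * linForm c ^ (k * p) := by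
    rw [h, mul_pow, MvPolynomial.C_pow, ← pow_mul, mul_comm p k]
  rw [hsNorm, spectralNorm, hfk, tensorOf_linForm_pow, Tensor.hsNorm_smul_pure_const,
    Tensor.spectralNorm_smul_pure_const _ hc, abs_pow]
  exact ⟨rfl, rfl⟩

/-- The norm is submultiplicative on powers of a form. -/
theorem hsNorm_pow_add_le {p : ℕ} {f : MvPolynomial (Fin n) ℝ} (hf : f.IsHomogeneous p)
    (k l : ℕ) : hsNorm ((k + l) * p) (f ^ (k + l))
      ≤ hsNorm (k * p) (f ^ k) * hsNorm (l * p) (f ^ l) := by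
  rw [add_mul, pow_add]
  exact hsNorm_mul_le (isHomogeneous_pow hf k) (isHomogeneous_pow hf l)

theorem hsNorm_pow_add_lt {p : ℕ} (hp : 1 ≤ p) {f : MvPolynomial (Fin n) ℝ}
    (hf : f.IsHomogeneous p) (hf0 : f ≠ 0)
    (hlin : ¬ ∃ (a : ℝ) (c : EuclideanSpace ℝ (Fin n)), a ≠ 0 ∧ c ≠ 0 ∧
      f = MvPolynomial.C a * linForm c ^ p) {k l : ℕ} (hk : 1 ≤ k) (hl : 1 ≤ l) :
    hsNorm ((k + l) * p) (f ^ (k + l))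
      < hsNorm (k * p) (f ^ k) * hsNorm (l * p) (f ^ l) := by
  by_contra! hcon
  rw [add_mul, pow_add] at hcon
  unfold hsNorm at hcon
  rw [tensorOf_mul (isHomogeneous_pow hf k) (isHomogeneous_pow hf l),
    ← Tensor.hsNorm_outer] at hcon
  obtain ⟨a, c, hac⟩ := Tensor.eq_smul_pure_of_outer_isSymm (Nat.mul_pos hl hp)
    (tensorOf_ne_zero (isHomogeneous_pow hf l) (pow_ne_zero l hf0))
    (Tensor.isSymm_of_hsNorm_le hcon)
  exact hlin (exists_eq_linForm_pow_of_pow_eq hp hk hf hf0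
    (eq_linForm_pow_of_tensorOf_eq (isHomogeneous_pow hf k) hac))

/-- The spectral norm of a form is the maximum of its absolute value on the unit sphere. -/
theorem exists_spectralNorm_eq_abs_eval {p : ℕ} (hn : 1 ≤ n) (hp : 1 ≤ p)
    {f : MvPolynomial (Fin n) ℝ} (hf : f.IsHomogeneous p) :
    ∃ x : EuclideanSpace ℝ (Fin n), ‖x‖ = 1 ∧ spectralNorm p f = |f.eval fun m => x m| := by
  obtain ⟨x, hx, h⟩ := (tensorOf_isSymm (d := p) f).exists_spectralNorm_eq hn hp
  exact ⟨x, hx, by rw [eval_eq_inner_tensorOf hf, spectralNorm, h]⟩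

theorem spectralNorm_pos {p : ℕ} (hn : 1 ≤ n) {f : MvPolynomial (Fin n) ℝ}
    (hf : f.IsHomogeneous p) (hf0 : f ≠ 0) : 0 < spectralNorm p f := by
  by_contra! h
  apply hf0
  refine MvPolynomial.funext fun y => ?_
  have h1 := (tensorOf p f).abs_form_le hn fun _ => WithLp.toLp 2 y
  rw [Tensor.form_apply, ← eval_eq_inner_tensorOf hf] at h1
  have h2 : (tensorOf p f).spectralNorm = 0 := le_antisymm h (Tensor.spectralNorm_nonneg _)
  rw [h2, zero_mul] at h1
  simpa using abs_nonpos_iff.1 h1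

theorem spectralNorm_pow_lt_hsNorm {p : ℕ} (hp : 1 ≤ p) {f : MvPolynomial (Fin n) ℝ}
    (hf : f.IsHomogeneous p) (hf0 : f ≠ 0)
    (hlin : ¬ ∃ (a : ℝ) (c : EuclideanSpace ℝ (Fin n)), a ≠ 0 ∧ c ≠ 0 ∧
      f = MvPolynomial.C a * linForm c ^ p) {k : ℕ} (hk : 1 ≤ k) :
    spectralNorm p f ^ k < hsNorm (k * p) (f ^ k) := by
  obtain ⟨x, hx, hM⟩ :=
    exists_spectralNorm_eq_abs_eval (dim_pos_of_homogeneous hp hf hf0) hp hf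
  have hfk := isHomogeneous_pow hf k
  have h1 : spectralNorm p f ^ k
      = |Tensor.inner (tensorOf (k * p) (f ^ k)) (Tensor.pure fun _ => x)| := by
    rw [← eval_eq_inner_tensorOf hfk, map_pow, abs_pow, hM]
  by_contra! hcon
  set T := tensorOf (k * p) (f ^ k) with hT
  set P : Tensor (k * p) n := Tensor.pure fun _ => x with hP
  have hPP : Tensor.inner P P = 1 := by
    rw [hP, Tensor.inner_pure_pure]
    simp [hx]
  have h2 : Tensor.inner T T ≤ Tensor.inner T P ^ 2 := by
    rw [← Tensor.hsNorm_sq, ← sq_abs (Tensor.inner T P), ← h1]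
    exact pow_le_pow_left₀ T.hsNorm_nonneg hcon 2
  -- Equality in Cauchy-Schwarz: the component of `T` orthogonal to the unit tensor `P` has squared
  -- norm `⟨T, T⟩ - ⟨T, P⟩ ^ 2`, so it vanishes.
  have h3 := Tensor.inner_sub_smul_self T P (Tensor.inner T P)
  have h4 : Tensor.inner (T - Tensor.inner T P • P) (T - Tensor.inner T P • P) = 0 := by
    refine le_antisymm ?_ (Tensor.inner_self_nonneg _)
    rw [h3, hPP]
    linarith
  exact hlin (exists_eq_linForm_pow_of_pow_eq hp hk hf hf0
    (eq_linForm_pow_of_tensorOf_eq hfk (sub_eq_zero.1 (Tensor.inner_self_eq_zero h4))))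

/-! ### Fekete's lemma and the limit -/

/-- **Fekete's lemma** for submultiplicative sequences whose terms are bounded below by a
geometric progression. -/
theorem exists_tendsto_rpow_inv_of_submultiplicative {u : ℕ → ℝ} {m : ℝ} (hm : 0 < m)
    (hmu : ∀ k, m ^ k ≤ u k) (hu : ∀ k l, u (k + l) ≤ u k * u l) :
    ∃ ρ : ℝ, Tendsto (fun k : ℕ => u k ^ (1 / (k : ℝ))) atTop (𝓝 ρ) ∧ m ≤ ρ ∧
      ∀ k : ℕ, 1 ≤ k → ρ ≤ u k ^ (1 / (k : ℝ)) := by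
  have hpos : ∀ k, 0 < u k := fun k => (pow_pos hm k).trans_le (hmu k)
  have hsub : Subadditive fun k => Real.log (u k) := fun k l => by
    rw [← Real.log_mul (hpos k).ne' (hpos l).ne']
    exact Real.log_le_log (hpos _) (hu k l)
  have hlog : ∀ k : ℕ, 1 ≤ k → Real.log m ≤ Real.log (u k) / k := fun k hk => by
    rw [le_div_iff₀ (by exact_mod_cast hk), mul_comm, ← Real.log_pow]
    exact Real.log_le_log (pow_pos hm k) (hmu k)
  have hbdd : BddBelow (Set.range fun k : ℕ => Real.log (u k) / k) := by
    -- The `0` accounts for `k = 0`, where division by zero gives the value `0`.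
    refine ⟨min 0 (Real.log m), ?_⟩
    rintro _ ⟨k, rfl⟩
    obtain rfl | hk := Nat.eq_zero_or_pos k
    · simp
    · exact (min_le_right _ _).trans (hlog k hk)
  have hexp : ∀ k : ℕ, u k ^ (1 / (k : ℝ)) = Real.exp (Real.log (u k) / k) := fun k => by
    rw [Real.rpow_def_of_pos (hpos k), mul_one_div]
  have hlim := hsub.tendsto_lim hbdd
  refine ⟨Real.exp hsub.lim, ?_, ?_, fun k hk => ?_⟩
  · simp only [hexp]
    exact (Real.continuous_exp.tendsto _).comp hlim
  · rw [← Real.log_le_iff_le_exp hm]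
    exact ge_of_tendsto hlim ((eventually_ge_atTop 1).mono hlog)
  · rw [hexp]
    exact Real.exp_le_exp.2 (hsub.lim_le_div hbdd (by lia))

end PolyNorm

theorem theorem2p2 (n p : ℕ) (hp : 1 ≤ p) (f : MvPolynomial (Fin n) ℝ)
    (hf : f.IsHomogeneous p) (hf0 : f ≠ 0) :
    (∀ (a : ℝ) (c : EuclideanSpace ℝ (Fin n)), a ≠ 0 → c ≠ 0 →
      f = MvPolynomial.C a * PolyNorm.linForm c ^ p →
      ∀ k : ℕ, 1 ≤ k →
        PolyNorm.hsNorm (k * p) (f ^ k) = PolyNorm.spectralNorm (k * p) (f ^ k) ∧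
        PolyNorm.spectralNorm (k * p) (f ^ k) = |a| ^ k * ‖c‖ ^ (k * p)) ∧
    ((¬ ∃ (a : ℝ) (c : EuclideanSpace ℝ (Fin n)), a ≠ 0 ∧ c ≠ 0 ∧
        f = MvPolynomial.C a * PolyNorm.linForm c ^ p) →
      (∀ k l : ℕ, 1 ≤ k → 1 ≤ l →
        PolyNorm.hsNorm ((k + l) * p) (f ^ (k + l)) <
          PolyNorm.hsNorm (k * p) (f ^ k) * PolyNorm.hsNorm (l * p) (f ^ l)) ∧
      (∀ k : ℕ, 1 ≤ k →
        PolyNorm.hsNorm ((2 * k) * p) (f ^ (2 * k)) < PolyNorm.hsNorm (k * p) (f ^ k) ^ 2) ∧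
      (∀ k : ℕ, 1 ≤ k →
        PolyNorm.spectralNorm p f ^ k < PolyNorm.hsNorm (k * p) (f ^ k)) ∧
      ∃ ρ : ℝ,
        Tendsto (fun k : ℕ => PolyNorm.hsNorm (k * p) (f ^ k) ^ (1 / (k : ℝ))) atTop (𝓝 ρ) ∧
        PolyNorm.spectralNorm p f ≤ ρ ∧
        ∀ k : ℕ, 1 ≤ k → ρ < PolyNorm.hsNorm (k * p) (f ^ k) ^ (1 / (k : ℝ))) := by
  have hn := PolyNorm.dim_pos_of_homogeneous hp hf hf0
  refine ⟨fun a c _ hc h k _ => ?_, fun hlin => ?_⟩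
  · obtain ⟨h1, h2⟩ := PolyNorm.norms_pow_of_eq_linForm_pow k hc h
    exact ⟨h1.trans h2.symm, h2⟩
  have hlt : ∀ k l : ℕ, 1 ≤ k → 1 ≤ l → PolyNorm.hsNorm ((k + l) * p) (f ^ (k + l)) <
      PolyNorm.hsNorm (k * p) (f ^ k) * PolyNorm.hsNorm (l * p) (f ^ l) := fun k l hk hl =>
    PolyNorm.hsNorm_pow_add_lt hp hf hf0 hlin hk hl
  have hsq : ∀ k : ℕ, 1 ≤ k → PolyNorm.hsNorm ((2 * k) * p) (f ^ (2 * k)) <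
      PolyNorm.hsNorm (k * p) (f ^ k) ^ 2 := fun k hk => by
    rw [two_mul, sq]
    exact hlt k k hk hk
  have hσ : ∀ k : ℕ, 1 ≤ k →
      PolyNorm.spectralNorm p f ^ k < PolyNorm.hsNorm (k * p) (f ^ k) := fun k hk =>
    PolyNorm.spectralNorm_pow_lt_hsNorm hp hf hf0 hlin hk
  -- The lower bound in Fekete's lemma is also required at `k = 0`; it follows from
  -- submultiplicativity at `0 + 1` after cancelling the positive norm of `f ^ 1`.
  have hone : 1 ≤ PolyNorm.hsNorm (0 * p) (f ^ 0) := by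
    have h := PolyNorm.hsNorm_pow_add_le hf 0 1
    have h1 : 0 < PolyNorm.hsNorm (1 * p) (f ^ 1) :=
      (pow_pos (PolyNorm.spectralNorm_pos hn hf hf0) 1).trans (hσ 1 le_rfl)
    rw [zero_add] at h
    exact le_of_mul_le_mul_right (by rwa [one_mul]) h1
  obtain ⟨ρ, hρ, hρσ, hρle⟩ := PolyNorm.exists_tendsto_rpow_inv_of_submultiplicative
    (u := fun k => PolyNorm.hsNorm (k * p) (f ^ k)) (PolyNorm.spectralNorm_pos hn hf hf0)
    (fun k => by
      obtain rfl | hk := Nat.eq_zero_or_pos k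
      · simpa using hone
      · exact (hσ k hk).le)
    (PolyNorm.hsNorm_pow_add_le hf)
  -- The weak bound at `2 * k` combined with the strict inequality for the square gives the strict
  -- bound at `k`.
  refine ⟨hlt, hsq, hσ, ρ, hρ, hρσ, fun k hk => (hρle (2 * k) (by lia)).trans_lt ?_⟩
  have hk0 : (0 : ℝ) < k := by exact_mod_cast hk
  calc PolyNorm.hsNorm ((2 * k) * p) (f ^ (2 * k)) ^ (1 / ((2 * k : ℕ) : ℝ))
      < (PolyNorm.hsNorm (k * p) (f ^ k) ^ 2) ^ (1 / ((2 * k : ℕ) : ℝ)) :=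
        Real.rpow_lt_rpow (PolyNorm.hsNorm_nonneg _) (hsq k hk) (by positivity)
    _ = PolyNorm.hsNorm (k * p) (f ^ k) ^ (1 / (k : ℝ)) := by
        rw [← Real.rpow_natCast, ← Real.rpow_mul (PolyNorm.hsNorm_nonneg _)]
        congr 1
        push_cast
        field_simp
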